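/- A Noetherian local ring (commutative, with non-zero identity) is called Gorenstein if it has finite injective dimension as a module over itself, and a proper ideal $I$ of a Gorenstein local ring $R$ is called a Gorenstein ideal if the factor ring $R/I$ is also Gorenstein. Let $R$ be a Gorenstein local ring and let $y \in R$ be a non-nilpotent zero-divisor, that is, $y^n \neq 0$ for all $n \geq 1$ and $yz = 0$ for some $z \neq 0$ in $R$. Then there is an integer $N$ such that, for every $n \geq N$, the ideal $Ry^n$ is not a Gorenstein ideal. -/

import Mathlib

universe u

/-- A commutative ring is a Gorenstein local ring if it is local (in particular nonzero),
Noetherian, and has finite injective dimension as a module over itself. -/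
structure IsGorensteinLocalRing (R : Type u) [CommRing R] : Prop where
  isLocalRing : IsLocalRing R
  isNoetherianRing : IsNoetherianRing R
  exists_injectiveDimensionLE :
    ∃ d : ℕ, CategoryTheory.HasInjectiveDimensionLE (ModuleCat.of R R) d

/-- An ideal `I` of a (Gorenstein local) ring `R` is a Gorenstein ideal if the factor ring
`R ⧸ I` is a Gorenstein local ring. -/
def IsGorensteinIdeal {R : Type u} [CommRing R] (I : Ideal R) : Prop :=
  IsGorensteinLocalRing (R ⧸ I)

open CategoryTheory Abelian IsLocalRing RingTheory.Sequence

/-! Suppose `y ^ n` generates a Gorenstein ideal for infinitely many `n`. The annihilators of the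
powers of `y` stabilize. If every Gorenstein `I = (y ^ m)` is the annihilator of its own
annihilator, then `y ^ n ∈ (y ^ m)` for some large `n < m`. So `y ^ n` is killed by some `1 - c * y
^ (k + 1)`, a unit as `y` lies in the maximal ideal, and `y` is nilpotent.

The double annihilator property says that `R ⧸ I` embeds in its bidual, which follows from `Ext^i(R
⧸ I, R) = 0` for all `i > 0` (`SelfExtVanishesFrom.mem_of_forall_mul_eq_zero`). That vanishing is
`IsGorensteinIdeal.extVanishes`: Gorenstein rings are Cohen-Macaulay, and a nonzero element killed
by `I` makes `R ⧸ I` maximal Cohen-Macaulay over `R`. Depth and dimension are handled through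
regular sequences and primes containing them. -/

/-- The vanishing of `Ext^i(N, M)` for unbundled modules. -/
abbrev ExtVanishes (R : Type u) [CommRing R] (N M : Type u) [AddCommGroup N] [Module R N]
    [AddCommGroup M] [Module R M] (i : ℕ) : Prop :=
  Subsingleton (Ext (ModuleCat.of R N) (ModuleCat.of R M) i)

/-! ### Long exact sequences and Nakayama's lemma for Ext -/

namespace ExtVanishes

variable {R : Type u} [CommRing R] {N N₁ N₂ N₃ M : Type u} [AddCommGroup N] [Module R N]
  [AddCommGroup N₁] [Module R N₁] [AddCommGroup N₂] [Module R N₂] [AddCommGroup N₃] [Module R N₃]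
  [AddCommGroup M] [Module R M]

theorem zero_iff : ExtVanishes R N M 0 ↔ Subsingleton (N →ₗ[R] M) :=
  (Ext.addEquiv₀.trans ModuleCat.homAddEquiv).toEquiv.subsingleton_congr

theorem of_subsingleton [Subsingleton N] (i : ℕ) : ExtVanishes R N M i := by
  refine subsingleton_of_forall_eq 0 fun e ↦ ?_
  have h : Limits.IsZero (ModuleCat.of R N) := ModuleCat.isZero_of_subsingleton _
  rw [← e.mk₀_id_comp, h.eq_zero_of_src (𝟙 _), Ext.mk₀_zero, Ext.zero_comp]

theorem of_projective [Module.Projective R N] (i : ℕ) (hi : i ≠ 0) : ExtVanishes R N M i := by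
  obtain ⟨j, rfl⟩ := Nat.exists_eq_succ_of_ne_zero hi
  have : Projective (ModuleCat.of R N) := (IsProjective.iff_projective N).mp ‹_›
  exact Ext.subsingleton_of_projective _ _ j

section

variable {f : N₁ →ₗ[R] N₂} {g : N₂ →ₗ[R] N₃} (hf : Function.Injective f)
  (hg : Function.Surjective g) (hfg : Function.Exact f g)

include hf hg hfg

theorem middle {i : ℕ} (h₁ : ExtVanishes R N₁ M i) (h₃ : ExtVanishes R N₃ M i) :
    ExtVanishes R N₂ M i := by
  have hS := ModuleCat.shortComplex_shortExact
    (ModuleCat.shortComplexOfCompEqZero f g hfg.linearMap_comp_eq_zero) hfg hf hg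
  refine subsingleton_of_forall_eq 0 fun e ↦ ?_
  obtain ⟨e', rfl⟩ := Ext.contravariant_sequence_exact₂ hS _ e (h₁.elim _ _)
  rw [h₃.elim e' 0, Ext.comp_zero]

theorem left {i j : ℕ} (hij : 1 + i = j) (h₂ : ExtVanishes R N₂ M i) (h₃ : ExtVanishes R N₃ M j) :
    ExtVanishes R N₁ M i := by
  have hS := ModuleCat.shortComplex_shortExact
    (ModuleCat.shortComplexOfCompEqZero f g hfg.linearMap_comp_eq_zero) hfg hf hg
  refine subsingleton_of_forall_eq 0 fun e ↦ ?_
  obtain ⟨e', rfl⟩ := Ext.contravariant_sequence_exact₁ hS _ e hij (h₃.elim _ _)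
  rw [h₂.elim e' 0, Ext.comp_zero]

theorem right {i j : ℕ} (hij : 1 + i = j) (h₁ : ExtVanishes R N₁ M i) (h₂ : ExtVanishes R N₂ M j) :
    ExtVanishes R N₃ M j := by
  have hS := ModuleCat.shortComplex_shortExact
    (ModuleCat.shortComplexOfCompEqZero f g hfg.linearMap_comp_eq_zero) hfg hf hg
  refine subsingleton_of_forall_eq 0 fun e ↦ ?_
  obtain ⟨e', rfl⟩ := Ext.contravariant_sequence_exact₃ hS _ e (h₂.elim _ _) hij
  rw [h₁.elim e' 0, Ext.comp_zero]

theorem lcomp_surjective (h₃ : ExtVanishes R N₃ M 1) :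
    Function.Surjective (LinearMap.lcomp R M f) := by
  intro φ
  have hS := ModuleCat.shortComplex_shortExact
    (ModuleCat.shortComplexOfCompEqZero f g hfg.linearMap_comp_eq_zero) hfg hf hg
  obtain ⟨e', he⟩ := Ext.contravariant_sequence_exact₁ hS _ (Ext.mk₀ (ModuleCat.ofHom φ))
    (add_zero 1) (h₃.elim _ _)
  obtain ⟨ψ, rfl⟩ := Ext.homEquiv₀.symm.surjective e'
  refine ⟨ψ.hom, ?_⟩
  simp only [Ext.homEquiv₀_symm_apply, Ext.mk₀_comp_mk₀] at he
  have := (Ext.mk₀_bijective _ _).1 he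
  exact congrArg ModuleCat.Hom.hom this

end

theorem congr (e : N₁ ≃ₗ[R] N₂) {i : ℕ} (h : ExtVanishes R N₁ M i) : ExtVanishes R N₂ M i :=
  middle (N₃ := PUnit) (f := e.toLinearMap) (g := 0) e.injective
    (fun _ ↦ ⟨0, Subsingleton.elim _ _⟩) (fun x ↦ by simp) h (of_subsingleton i)

/-- Multiplication by `x` is surjective on the finitely generated module `Ext^i(N, M)`, which
therefore vanishes by Nakayama. -/
theorem of_isSMulRegular [IsNoetherianRing R] [IsLocalRing R] [Module.Finite R N]
    [Module.Finite R M] {x : R} (hx : x ∈ maximalIdeal R) (hreg : IsSMulRegular N x) {i : ℕ}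
    (h : ExtVanishes R (QuotSMulTop x N) M (i + 1)) : ExtVanishes R N M i := by
  have hS := IsSMulRegular.smulShortComplex_shortExact (M := ModuleCat.of R N) hreg
  by_contra! ntr
  have hmem : x ∈ (Module.annihilator R
      (Ext (ModuleCat.of R N) (ModuleCat.of R M) i)).jacobson :=
    (IsLocalRing.maximalIdeal_le_jacobson _) hx
  refine Submodule.top_ne_pointwise_smul_of_mem_jacobson_annihilator hmem ?_
  rw [eq_comm, eq_top_iff]
  intro e _
  obtain ⟨e', rfl⟩ := Ext.contravariant_sequence_exact₁ hS _ e (add_comm 1 i) (h.elim _ _)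
  rw [ModuleCat.smulShortComplex_f_eq_smul_id]
  erw [Ext.mk₀_smul, Ext.smul_comp, Ext.mk₀_id_comp]
  exact Submodule.smul_mem_pointwise_smul _ _ ⊤ trivial

end ExtVanishes

/-- `Ext^i(N, R)` vanishes for all finitely generated `N` and all `i ≥ n`. -/
def SelfExtVanishesFrom (R : Type u) [CommRing R] (n : ℕ) : Prop :=
  ∀ i : ℕ, n ≤ i → ∀ (N : Type u) [AddCommGroup N] [Module R N] [Module.Finite R N],
    ExtVanishes R N R i

/-- Elements outside of a prime `p` are regular on any module isomorphic to `R ⧸ p`. -/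
theorem LinearEquiv.isSMulRegular_of_quotient_prime {R N : Type*} [CommRing R] [AddCommGroup N]
    [Module R N] {p : Ideal R} [p.IsPrime] (e : N ≃ₗ[R] R ⧸ p) {x : R} (hx : x ∉ p) :
    IsSMulRegular N x := by
  rw [e.isSMulRegular_congr]
  intro a b h
  have h' : Ideal.Quotient.mk p x * a = Ideal.Quotient.mk p x * b := h
  exact mul_left_cancel₀ (by simpa [Ideal.Quotient.eq_zero_iff_mem] using hx) h'

section

variable {R : Type u} [CommRing R] [IsLocalRing R]

theorem IsLocalRing.exists_mem_maximalIdeal_notMem {p : Ideal R} [hp : p.IsPrime]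
    (h : p ≠ maximalIdeal R) : ∃ x ∈ maximalIdeal R, x ∉ p := by
  by_contra! H
  exact h (le_antisymm (le_maximalIdeal hp.ne_top) H)

theorem RingTheory.Sequence.IsRegular.mem_maximalIdeal {rs : List R} (h : IsRegular R rs) :
    ∀ r ∈ rs, r ∈ maximalIdeal R := by
  intro x hx
  apply IsLocalRing.le_maximalIdeal h.2.symm
  simpa using (Ideal.mem_span x).mpr fun p a ↦ a hx

theorem maximalIdeal_smul_top_lt : maximalIdeal R • (⊤ : Submodule R R) < ⊤ := by
  simpa [lt_top_iff_ne_top] using (maximalIdeal.isMaximal R).ne_top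

end

/-! ### Injective dimension, depth and dimension -/

section

variable {R : Type u} [CommRing R] [IsNoetherianRing R] [IsLocalRing R]

/-- A prime filtration reduces to `R ⧸ p`. For non-maximal `p`, an element of the maximal ideal
outside `p` is regular on `R ⧸ p`, so Nakayama lifts the vanishing in degree `n + 1` to degree `n`.
-/
theorem SelfExtVanishesFrom.of_residue {n : ℕ} (h : SelfExtVanishesFrom R (n + 1))
    (hk : ExtVanishes R (R ⧸ maximalIdeal R) R n) : SelfExtVanishesFrom R n := by
  intro i hi N _ _ _
  obtain rfl | hi := hi.eq_or_lt
  swap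
  · exact h i hi N
  induction ‹Module.Finite R N› using
    IsNoetherianRing.induction_on_isQuotientEquivQuotientPrime R with
  | subsingleton N => exact .of_subsingleton _
  | quotient N p f =>
    by_cases hp : p.1 = maximalIdeal R
    · exact hk.congr (hp ▸ f.symm)
    · have := p.2
      obtain ⟨x, hx, hxp⟩ := exists_mem_maximalIdeal_notMem hp
      exact .of_isSMulRegular hx (f.isSMulRegular_of_quotient_prime hxp) (h _ le_rfl _)
  | exact N₁ N₂ N₃ f g hf hg hfg h₁ h₃ => exact .middle hf hg hfg h₁ h₃

/-- The `d` found here plays the role of the injective dimension of `R`. -/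
theorem exists_selfExt_residue_not_vanishes (h : ∃ n, SelfExtVanishesFrom R n) :
    ∃ d, SelfExtVanishesFrom R (d + 1) ∧ ¬ ExtVanishes R (R ⧸ maximalIdeal R) R d := by
  classical
  -- The least bound is positive because `Hom(R, R)` is nonzero.
  obtain ⟨d, hd⟩ := Nat.exists_eq_succ_of_ne_zero (n := Nat.find h) (by
    intro h0
    have h1 := Nat.find_spec h
    rw [h0] at h1
    have := ExtVanishes.zero_iff.mp (h1 0 le_rfl R)
    exact one_ne_zero (α := R) (congrArg (fun f : R →ₗ[R] R ↦ f 1)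
      (Subsingleton.elim LinearMap.id 0)))
  have hd' := Nat.find_spec h
  rw [hd] at hd'
  exact ⟨d, hd', fun hk ↦ Nat.find_min h (by omega) (hd'.of_residue hk)⟩

/-- The depth is at least `d`. If a regular sequence of length `j < d` could not be extended, the
residue field would embed in `R ⧸ (rs)`, of projective dimension `j`, and `Ext^d` of the residue
field would vanish. -/
theorem exists_isRegular_length {d : ℕ} (h : SelfExtVanishesFrom R (d + 1))
    (hk : ¬ ExtVanishes R (R ⧸ maximalIdeal R) R d) (j : ℕ) (hj : j ≤ d) :
    ∃ rs : List R, rs.length = j ∧ IsRegular R rs := by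
  induction j with
  | zero => exact ⟨[], rfl, IsRegular.nil R R⟩
  | succ j ih =>
    obtain ⟨rs, rfl, hrs⟩ := ih (by omega)
    have hsub : Subsingleton ((R ⧸ maximalIdeal R) →ₗ[R] (R ⧸ Ideal.ofList rs)) := by
      refine subsingleton_of_forall_eq 0 fun φ ↦ ?_
      by_contra hφ
      have hinj : Function.Injective φ := by
        have : IsSimpleModule R (R ⧸ maximalIdeal R) :=
          isSimpleModule_iff_isCoatom.mpr (maximalIdeal.isMaximal R).out
        exact (LinearMap.injective_or_eq_zero φ).resolve_right hφ
      have hpd : HasProjectiveDimensionLE (ModuleCat.of R (R ⧸ Ideal.ofList rs)) rs.length := by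
        rw [← projectiveDimension_le_iff,
          ← ModuleCat.projectiveDimension_quotient_eq_length rs hrs]
        exact (projectiveDimension_eq_of_iso (Shrink.linearEquiv R _).toModuleIso).ge
      exact hk (.left hinj (Submodule.mkQ_surjective _) (LinearMap.exact_map_mkQ_range φ)
        (add_comm 1 d) (hpd.subsingleton _ _ d (by omega) _) (h _ le_rfl _))
    obtain ⟨r, hr, hreg⟩ := IsSMulRegular.subsingleton_linearMap_iff.mp hsub
    rw [Ideal.annihilator_quotient] at hr
    refine ⟨rs ++ [r], by simp, ?_⟩
    refine (IsLocalRing.isRegular_iff_isWeaklyRegular_of_subset_maximalIdeal ?_).mpr ?_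
    · intro x hx
      rcases List.mem_append.mp hx with hx | hx
      · exact hrs.mem_maximalIdeal x hx
      · rwa [List.mem_singleton.mp hx]
    · rw [isWeaklyRegular_append_iff]
      refine ⟨hrs.1, (isWeaklyRegular_singleton_iff _ _).mpr ?_⟩
      exact ((Submodule.quotEquivOfEq _ _ (by simp)).isSMulRegular_congr r).mpr hreg

/-- The dimension is at most `d`. For another prime `p`, `Ext^d(R ⧸ p, R) = 0` by Nakayama, while
the kernel of `R ⧸ p → R ⧸ 𝔪` is supported where `rs` vanishes, so its `Ext^(d-1)` is zero too;
hence `Ext^d(R ⧸ 𝔪, R) = 0`. -/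
theorem eq_maximalIdeal_of_isRegular {d : ℕ} (h : SelfExtVanishesFrom R (d + 1))
    (hk : ¬ ExtVanishes R (R ⧸ maximalIdeal R) R d) {rs : List R} (hlen : rs.length = d)
    (hrs : IsRegular R rs) (p : Ideal R) [hp : p.IsPrime] (hle : Ideal.ofList rs ≤ p) :
    p = maximalIdeal R := by
  by_contra hne
  obtain ⟨x, hx, hxp⟩ := exists_mem_maximalIdeal_notMem hne
  have hv : ExtVanishes R (R ⧸ p) R d := .of_isSMulRegular hx
    ((LinearEquiv.refl R (R ⧸ p)).isSMulRegular_of_quotient_prime hxp) (h _ le_rfl _)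
  let g := Submodule.factor (le_maximalIdeal hp.ne_top)
  have hg : Function.Surjective g := Submodule.factor_surjective _
  apply hk
  obtain _ | d := d
  · rw [ExtVanishes.zero_iff] at hv ⊢
    exact subsingleton_of_forall_eq 0 fun φ ↦ LinearMap.ext fun x ↦ by
      obtain ⟨y, rfl⟩ := hg x
      exact LinearMap.congr_fun (hv.elim (φ ∘ₗ g) 0) y
  · refine .right (LinearMap.ker g).injective_subtype hg (LinearMap.exact_subtype_ker_map g)
      (add_comm 1 d) ?_ hv
    refine ModuleCat.subsingleton_ext_of_exists_isRegular (Ideal.ofList rs) _ ?_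
      (ModuleCat.of R R) ?_ rs (fun r hr ↦ Ideal.subset_span hr) hrs d (by omega)
    · refine (Module.support_subset_of_injective _ (LinearMap.ker g).injective_subtype).trans ?_
      rw [Module.support_eq_zeroLocus, Ideal.annihilator_quotient]
      exact PrimeSpectrum.zeroLocus_anti_mono hle
    · exact lt_top_iff_ne_top.mpr hrs.2.symm

/-- Ischebeck's theorem, with `xs.length` bounding the dimension of `N`. Each element of `xs` is
moved into `I`; on a factor `R ⧸ p` it is either in `p`, or regular, which costs one Ext degree. -/
theorem extVanishes_of_forall_eq_maximalIdeal {d : ℕ} {rs : List R} (hlen : rs.length = d)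
    (hrs : IsRegular R rs) (xs : List R) (hxs : ∀ x ∈ xs, x ∈ maximalIdeal R) (I : Ideal R)
    (hI : ∀ p : Ideal R, p.IsPrime → I ⊔ Ideal.ofList xs ≤ p → p = maximalIdeal R)
    (N : Type u) [AddCommGroup N] [Module R N] [Module.Finite R N]
    (hN : Module.support R N ⊆ PrimeSpectrum.zeroLocus I) (i : ℕ) (hi : i + xs.length < d) :
    ExtVanishes R N R i := by
  induction xs generalizing I N i with
  | nil =>
    refine ModuleCat.subsingleton_ext_of_exists_isRegular (maximalIdeal R) (ModuleCat.of R N)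
      (hN.trans ?_) (ModuleCat.of R R) maximalIdeal_smul_top_lt rs hrs.mem_maximalIdeal hrs i
      (by simpa [hlen] using hi)
    intro p hp
    exact (hI p.1 p.2 (by simpa using hp)).ge
  | cons x xs ih =>
    replace ih := ih (fun y hy ↦ hxs y (List.mem_cons_of_mem _ hy)) (I ⊔ Ideal.span {x})
      (fun p hp h ↦ hI p hp (by simpa [sup_assoc] using h))
    simp only [List.length_cons] at hi
    have hxm := hxs x List.mem_cons_self
    induction ‹Module.Finite R N› using
      IsNoetherianRing.induction_on_isQuotientEquivQuotientPrime R with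
    | subsingleton N => exact .of_subsingleton _
    | quotient N p f =>
      by_cases hp : x ∈ p.1
      · refine ih N ?_ i (by omega)
        intro q hq
        have hpq : p.1 ≤ q.1 := by
          rw [f.support_eq, Module.support_eq_zeroLocus, Ideal.annihilator_quotient] at hq
          exact hq
        have := hN hq
        simp only [PrimeSpectrum.mem_zeroLocus, SetLike.coe_subset_coe, sup_le_iff,
          Ideal.span_singleton_le_iff_mem] at this ⊢
        exact ⟨this, hpq hp⟩
      · have := p.2
        refine .of_isSMulRegular hxm (f.isSMulRegular_of_quotient_prime hp)
          (ih _ ?_ (i + 1) (by omega))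
        rw [Module.support_quotSMulTop, PrimeSpectrum.zeroLocus_sup, PrimeSpectrum.zeroLocus_span]
        exact Set.inter_subset_inter_left _ hN
    | exact N₁ N₂ N₃ f g hf hg hfg h₁ h₃ =>
      rw [Module.support_of_exact hfg hf hg, Set.union_subset_iff] at hN
      exact .middle hf hg hfg (h₁ hN.1) (h₃ hN.2)

theorem SelfExtVanishesFrom.of_isWeaklyRegular {d : ℕ} (h : SelfExtVanishesFrom R (d + 1))
    (xs : List R) (hxs : ∀ x ∈ xs, x ∈ maximalIdeal R) (N : Type u) [AddCommGroup N] [Module R N]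
    [Module.Finite R N] (hN : IsWeaklyRegular N xs) (i : ℕ) (hi : d < i + xs.length) :
    ExtVanishes R N R i := by
  induction xs generalizing N i with
  | nil => exact h i (by simpa using hi) N
  | cons x xs ih =>
    rw [isWeaklyRegular_cons_iff] at hN
    simp only [List.length_cons] at hi
    exact .of_isSMulRegular (hxs x List.mem_cons_self) hN.1
      (ih (fun y hy ↦ hxs y (List.mem_cons_of_mem _ hy)) _ hN.2 (i + 1) (by omega))

end

/-! ### Duality into the ring -/

theorem LinearMap.exact_lcomp {R N₁ N₂ N₃ M : Type*} [CommRing R] [AddCommGroup N₁] [Module R N₁]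
    [AddCommGroup N₂] [Module R N₂] [AddCommGroup N₃] [Module R N₃] [AddCommGroup M] [Module R M]
    {f : N₁ →ₗ[R] N₂} {g : N₂ →ₗ[R] N₃} (hg : Function.Surjective g) (hfg : Function.Exact f g) :
    Function.Exact (LinearMap.lcomp R M g) (LinearMap.lcomp R M f) := by
  intro φ
  constructor
  · intro h
    have hle : LinearMap.ker g ≤ LinearMap.ker φ := by
      intro x hx
      obtain ⟨y, rfl⟩ := (hfg x).mp hx
      exact LinearMap.congr_fun h y
    refine ⟨((LinearMap.ker g).liftQ φ hle) ∘ₗ (g.quotKerEquivOfSurjective hg).symm, ?_⟩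
    ext x
    have : (g.quotKerEquivOfSurjective hg).symm (g x) = Submodule.Quotient.mk x := by
      rw [LinearEquiv.symm_apply_eq]; rfl
    simp [this]
  · rintro ⟨ψ, rfl⟩
    ext x
    simp [hfg.apply_apply_eq_zero]

theorem LinearMap.lcomp_injective {R N₂ N₃ M : Type*} [CommRing R] [AddCommGroup N₂] [Module R N₂]
    [AddCommGroup N₃] [Module R N₃] [AddCommGroup M] [Module R M]
    {g : N₂ →ₗ[R] N₃} (hg : Function.Surjective g) : Function.Injective (LinearMap.lcomp R M g) :=
  fun _ _ h ↦ LinearMap.ext fun x ↦ by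
    obtain ⟨y, rfl⟩ := hg x
    exact LinearMap.congr_fun h y

section

variable {R : Type u} [CommRing R] [IsNoetherianRing R]

/-- Over a ring of finite self-injective dimension, if `Ext^i(M, R)` vanishes for all `i > 0`, then
so does `Ext^j(M*, R)` for all `j > 0`. -/
theorem SelfExtVanishesFrom.dual {n : ℕ} (h : SelfExtVanishesFrom R n) (M : Type u)
    [AddCommGroup M] [Module R M] [Module.Finite R M] (hM : ∀ i ≠ 0, ExtVanishes R M R i) (j : ℕ)
    (hj : j ≠ 0) : ExtVanishes R (Module.Dual R M) R j := by
  -- Descending induction on `j`, with `k` bounding the distance to `n`: passing to a syzygy of `M`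
  -- raises `j` by one.
  suffices H : ∀ (k : ℕ) (M : Type u) [AddCommGroup M] [Module R M] [Module.Finite R M],
      (∀ i ≠ 0, ExtVanishes R M R i) → ∀ j ≠ 0, n ≤ j + k →
        ExtVanishes R (Module.Dual R M) R j from H n M hM j hj (by omega)
  intro k
  induction k with
  | zero => exact fun M _ _ _ _ j _ hk ↦ h j hk _
  | succ k ih =>
    intro M _ _ _ hM j hj hk
    obtain ⟨F, _, _, _, _, g, hg⟩ := Module.exists_finite_presentation R M
    have hfg := LinearMap.exact_subtype_ker_map g
    have hf := (LinearMap.ker g).injective_subtype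
    have hK : ∀ i ≠ 0, ExtVanishes R (LinearMap.ker g) R i := fun i hi ↦
      .left hf hg hfg rfl (.of_projective i hi) (hM _ (by omega))
    exact .left (LinearMap.lcomp_injective hg)
      (ExtVanishes.lcomp_surjective hf hg hfg (hM 1 one_ne_zero))
      (LinearMap.exact_lcomp hg hfg) rfl (.of_projective j hj) (ih _ hK _ (by omega) (by omega))

/-- Modules with vanishing higher Ext into `R` are torsionless. For a lift `a` of `x` to a free
cover, evaluation at `a` is shown to be evaluation at an element of the first syzygy; as free
modules are reflexive, `a` lies in that syzygy. -/
theorem SelfExtVanishesFrom.eq_zero_of_forall_dual {n : ℕ} (h : SelfExtVanishesFrom R n)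
    {M : Type u} [AddCommGroup M] [Module R M] [Module.Finite R M]
    (hM : ∀ i ≠ 0, ExtVanishes R M R i) {x : M} (hx : ∀ φ : Module.Dual R M, φ x = 0) : x = 0 := by
  obtain ⟨F, _, _, _, _, g, hg⟩ := Module.exists_finite_presentation R M
  have hfg := LinearMap.exact_subtype_ker_map g
  have hf := (LinearMap.ker g).injective_subtype
  have hK : ∀ i ≠ 0, ExtVanishes R (LinearMap.ker g) R i := fun i hi ↦
    .left hf hg hfg rfl (.of_projective i hi) (hM _ (by omega))
  obtain ⟨G, _, _, _, _, q, hq⟩ := Module.exists_finite_presentation R (LinearMap.ker g)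
  have hfg' := LinearMap.exact_subtype_ker_map q
  have hf' := (LinearMap.ker q).injective_subtype
  have hK' : ∀ i ≠ 0, ExtVanishes R (LinearMap.ker q) R i := fun i hi ↦
    .left hf' hq hfg' rfl (.of_projective i hi) (hK _ (by omega))
  obtain ⟨a, rfl⟩ := hg x
  -- evaluation at `a` descends to the dual of the first syzygy, then extends to the dual of `G`
  have hsurj := ExtVanishes.lcomp_surjective hf hg hfg (hM 1 one_ne_zero)
  obtain ⟨ε, hε⟩ := (LinearMap.exact_lcomp (M := R) hsurj (LinearMap.exact_lcomp hg hfg)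
    (Module.Dual.eval R F a)).mp (LinearMap.ext fun φ ↦ hx φ)
  obtain ⟨δ, hδ⟩ := ExtVanishes.lcomp_surjective (LinearMap.lcomp_injective hq)
    (ExtVanishes.lcomp_surjective hf' hq hfg' (hK 1 one_ne_zero)) (LinearMap.exact_lcomp hq hfg')
    (h.dual _ hK' 1 one_ne_zero) ε
  obtain ⟨b, rfl⟩ := (Module.evalEquiv R G).surjective δ
  have ha : (q b : F) = a := by
    apply (Module.evalEquiv R F).injective
    ext φ
    have h1 := LinearMap.congr_fun hε φ
    have h2 := LinearMap.congr_fun hδ (φ ∘ₗ (LinearMap.ker g).subtype)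
    exact h2.trans h1
  rw [← ha]
  exact (q b).2

/-- A functional on `R ⧸ I` is multiplication by its value at `1`, which `I` annihilates; so
torsionlessness is the double annihilator property. -/
theorem SelfExtVanishesFrom.mem_of_forall_mul_eq_zero {n : ℕ} (h : SelfExtVanishesFrom R n)
    {I : Ideal R} (hI : ∀ i ≠ 0, ExtVanishes R (R ⧸ I) R i) {a : R}
    (ha : ∀ b, (∀ c ∈ I, c * b = 0) → a * b = 0) : a ∈ I := by
  rw [← Ideal.Quotient.eq_zero_iff_mem]
  refine h.eq_zero_of_forall_dual hI fun φ ↦ ?_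
  have key (c : R) : φ (Ideal.Quotient.mk I c) = c * φ 1 := by
    rw [← smul_eq_mul, ← map_smul, Algebra.smul_def, mul_one]; rfl
  rw [key]
  refine ha _ fun c hc ↦ ?_
  rw [← key, Ideal.Quotient.eq_zero_iff_mem.mpr hc, map_zero]

end

/-! ### Gorenstein ideals with nonzero annihilator -/

theorem IsGorensteinLocalRing.exists_selfExtVanishesFrom {R : Type u} [CommRing R]
    (h : IsGorensteinLocalRing R) : ∃ n, SelfExtVanishesFrom R n := by
  obtain ⟨d, hd⟩ := h.exists_injectiveDimensionLE
  exact ⟨d + 1, fun i hi N _ _ _ ↦ hd.subsingleton _ _ i hi _⟩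

theorem IsGorensteinIdeal.extVanishes {R : Type u} [CommRing R] (hR : IsGorensteinLocalRing R)
    {I : Ideal R} (hI : IsGorensteinIdeal I) {z : R} (hz : z ≠ 0) (hIz : ∀ c ∈ I, c * z = 0) (i : ℕ)
    (hi : i ≠ 0) : ExtVanishes R (R ⧸ I) R i := by
  have := hR.isLocalRing
  have := hR.isNoetherianRing
  have := hI.isLocalRing
  have := hI.isNoetherianRing
  obtain ⟨d, hd, hkd⟩ := exists_selfExt_residue_not_vanishes hR.exists_selfExtVanishesFrom
  obtain ⟨e, he, hke⟩ := exists_selfExt_residue_not_vanishes hI.exists_selfExtVanishesFrom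
  obtain ⟨rs, hrs, hreg⟩ := exists_isRegular_length hd hkd d le_rfl
  obtain ⟨ys, hys, hyreg⟩ := exists_isRegular_length he hke e le_rfl
  obtain ⟨xs, rfl⟩ : ∃ xs : List R, xs.map (Ideal.Quotient.mk I) = ys :=
    ⟨ys.map (Function.surjInv Ideal.Quotient.mk_surjective), by
      simp [Function.comp_def, Function.surjInv_eq]⟩
  have hxs : ∀ x ∈ xs, x ∈ maximalIdeal R := fun x hx hu ↦
    hyreg.mem_maximalIdeal _ (List.mem_map_of_mem hx) (hu.map (Ideal.Quotient.mk I))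
  have hV : ∀ p : Ideal R, p.IsPrime → I ⊔ Ideal.ofList xs ≤ p → p = maximalIdeal R := by
    intro p hp hle
    have hIp : I ≤ p := le_sup_left.trans hle
    have hprime := Ideal.map_isPrime_of_surjective (f := Ideal.Quotient.mk I) (I := p)
      Ideal.Quotient.mk_surjective
      (by rwa [Ideal.mk_ker])
    have h := eq_maximalIdeal_of_isRegular he hke hys hyreg (p.map (Ideal.Quotient.mk I))
      (by rw [← Ideal.map_ofList]; exact Ideal.map_mono (le_sup_right.trans hle))
    rw [← Ideal.comap_map_mk hIp, h]
    exact eq_maximalIdeal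
      (Ideal.comap_isMaximal_of_surjective _ Ideal.Quotient.mk_surjective)
  -- Otherwise `R ⧸ I` would have dimension below `d` and `Hom(R ⧸ I, R) = 0`, yet `1 ↦ z` is a
  -- nonzero map.
  have hde : d ≤ e := by
    by_contra! hlt
    have := extVanishes_of_forall_eq_maximalIdeal hrs hreg xs hxs I hV (R ⧸ I)
      (by rw [Module.support_eq_zeroLocus, Ideal.annihilator_quotient]) 0 (by simp at hys; omega)
    rw [ExtVanishes.zero_iff] at this
    let φ : (R ⧸ I) →ₗ[R] R := Submodule.liftQ I (LinearMap.toSpanSingleton R R z) hIz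
    have hφ : φ (Ideal.Quotient.mk I 1) = 1 * z := rfl
    rw [this.elim φ 0] at hφ
    exact hz (by simpa using hφ.symm)
  -- The lifts `xs` form a weakly regular sequence of length `e ≥ d` on `R ⧸ I`, which kills every
  -- Ext in positive degree.
  refine hd.of_isWeaklyRegular xs hxs (R ⧸ I) ?_ i (by simp at hys; omega)
  exact (isWeaklyRegular_map_algebraMap_iff (R ⧸ I) (R ⧸ I) xs).mp hyreg.1

theorem corollary3p9 {R : Type u} [CommRing R] (hR : IsGorensteinLocalRing R)
    (y : R) (hnil : ¬ IsNilpotent y) (hy : y ∉ nonZeroDivisors R) :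
    ∃ N : ℕ, ∀ n : ℕ, N ≤ n → ¬ IsGorensteinIdeal (Ideal.span {y ^ n}) := by
  have := hR.isLocalRing
  have := hR.isNoetherianRing
  obtain ⟨z, hyz, hz⟩ : ∃ z, y * z = 0 ∧ z ≠ 0 := by
    simpa [mem_nonZeroDivisors_iff_right, mul_comm] using hy
  obtain ⟨n₀, hn₀⟩ := hR.exists_selfExtVanishesFrom
  let K : ℕ →o Ideal R := ⟨fun n ↦ LinearMap.ker (LinearMap.mulLeft R (y ^ n)), fun m n hmn x hx ↦ by
    obtain ⟨k, rfl⟩ := Nat.exists_eq_add_of_le' hmn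
    simp only [LinearMap.mem_ker, LinearMap.mulLeft_apply] at hx ⊢
    rw [pow_add, mul_assoc, hx, mul_zero]⟩
  obtain ⟨N, hN⟩ := monotone_stabilizes_iff_noetherian.mpr ‹IsNoetherianRing R› K
  by_contra! H
  obtain ⟨n, hn, hGn⟩ := H (N + 1)
  obtain ⟨m, hm, hGm⟩ := H (n + 1)
  -- The annihilators of `y ^ m` and `y ^ n` coincide, so `y ^ n` lies in the double annihilator of
  -- `(y ^ m)`.
  have hmem : y ^ n ∈ Ideal.span {y ^ m} := by
    refine hn₀.mem_of_forall_mul_eq_zero (hGm.extVanishes hR hz ?_) fun b hb ↦ ?_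
    · intro c hc
      obtain ⟨c, rfl⟩ := Ideal.mem_span_singleton'.mp hc
      obtain ⟨k, rfl⟩ := Nat.exists_eq_add_of_lt (by omega : 0 < m)
      rw [pow_succ, mul_assoc, mul_assoc, hyz, mul_zero, mul_zero]
    · have h1 : b ∈ K m := hb _ (Ideal.mem_span_singleton_self _)
      rw [← hN m (by omega), hN n (by omega)] at h1
      exact h1
  obtain ⟨c, hc⟩ := Ideal.mem_span_singleton'.mp hmem
  obtain ⟨k, rfl⟩ := Nat.exists_eq_add_of_le hm
  have hyu : y ∈ maximalIdeal R := by
    rw [mem_maximalIdeal, mem_nonunits_iff]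
    exact fun hu ↦ hy hu.mem_nonZeroDivisors
  have hunit : IsUnit (1 - c * y ^ k * y) := by
    by_contra hnu
    have h1 : c * y ^ k * y ∈ maximalIdeal R := Ideal.mul_mem_left _ _ hyu
    have h2 := Ideal.add_mem _ ((mem_maximalIdeal _).mpr hnu) h1
    rw [sub_add_cancel] at h2
    exact (mem_maximalIdeal _).mp h2 isUnit_one
  refine hnil ⟨n, (hunit.mul_left_eq_zero).mp (?_ : y ^ n * _ = 0)⟩
  linear_combination -hc
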